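/- Let $X$ and $U$ be Polish spaces with their Borel $\sigma$-algebras, with $U$ compact and non-empty. Let $\mathcal T$ and $\mathcal S$ be transition probability kernels from $X\times U$ to $X$, and let $c,\hat c:X\times U\to[0,\infty)$ be bounded and continuous. Assume that $\mathcal T$ and $\mathcal S$ are weakly continuous, i.e. for every $v\in C_b(X)$ the maps $(x,u)\mapsto\int v\,d\mathcal T(\cdot|x,u)$ and $(x,u)\mapsto\int v\,d\mathcal S(\cdot|x,u)$ are continuous on $X\times U$. Let $\epsilon>0$ and let $\rho,\tau$ be probability measures on $X$ such that, for all $x\in X$, $u\in U$ and Borel sets $A\subseteq X$, $$\mathcal T(A|x,u)\ge\epsilon\,\rho(A),\qquad \mathcal S(A|x,u)\ge\epsilon\,\tau(A).$$ An admissible policy is a sequence $\gamma=(\gamma_t)_{t\ge0}$ of measurable maps $\gamma_t$ from histories $(x_0,u_0,\dots,x_{t-1},u_{t-1},x_t)$ to probability measures on $U$. For an admissible policy $\gamma$ let $$J_\infty(c,\mathcal T,\gamma)(x)=\limsup_{N\to\infty}\frac1N\,\mathbb E^{\mathcal T,\gamma}\Big[\sum_{t=0}^{N-1}c(X_t,U_t)\,\Big|\,X_0=x\Big],\qquad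 J_\infty^*(c,\mathcal T)(x)=\inf_\gamma J_\infty(c,\mathcal T,\gamma)(x),$$ the infimum being over all admissible policies. A measurable $\gamma:X\to U$ is identified with the deterministic stationary policy $U_t=\gamma(X_t)$. For $f\in C_b(X)$ put $d_f(\mu,\nu)=\left|\int f\,d\mu-\int f\,d\nu\right|$ for probability measures $\mu,\nu$ on $X$, and $d_f(\mathcal T,\mathcal S)=\sup_{x,u}d_f(\mathcal T(\cdot|x,u),\mathcal S(\cdot|x,u))$. Call $(g,h,\gamma)$, with $g\in\mathbb R$, $h\in C_b(X)$ and $\gamma:X\to U$ measurable, a canonical triplet for $(\hat c,\mathcal S)$ if for all $x\in X$ $$g+h(x)=\inf_{u\in U}\Big\{\hat c(x,u)+\int h(y)\,\mathcal S(dy|x,u)\Big\}=\hat c(x,\gamma(x))+\int h(y)\,\mathcal S(dy|x,\gamma(x)).$$ Then the operator $$v\mapsto\Big(x\mapsto\inf_{u\in U}\Big\{c(x,u)+\int v(y)\,\big(\mathcal T(dy|x,u)-\epsilon\rho(dy)\big)\Big\}\Big)$$ has a unique fixed point $h^*_{c,\mathcal T}$ in $C_b(X)$; a canonical triplet for $(\hat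 c,\mathcal S)$ exists; and for every canonical triplet $(\hat g,\hat h,\gamma^*_{\hat c,\mathcal S})$ for $(\hat c,\mathcal S)$, $$\left\|J_\infty(c,\mathcal T,\gamma^*_{\hat c,\mathcal S})-J_\infty^*(c,\mathcal T)\right\|_\infty\le\frac{2+\epsilon}{\epsilon}\Big(\|c-\hat c\|_\infty+d_{h^*_{c,\mathcal T}}(\mathcal T,\mathcal S)\Big)+(2+\epsilon)\,d_{h^*_{c,\mathcal T}}(\rho,\tau).$$ -/

import Mathlib

open MeasureTheory ProbabilityTheory Filter
open scoped BoundedContinuousFunction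

namespace MDP

noncomputable section

/-- A history at time `t`: the state-action pairs at times `0, …, t - 1` together with the current
state (this is `X^{t+1} × U^t`, regrouped). -/
abbrev Hist (X U : Type*) (t : ℕ) : Type _ := (Fin t → X × U) × X

/-- An admissible (randomized, history dependent) policy: at each time a measurable map from
histories to probability measures on actions. -/
structure Policy (X U : Type*) [MeasurableSpace X] [MeasurableSpace U] where
  kernel : ∀ t : ℕ, Kernel (Hist X U t) U
  markov : ∀ t : ℕ, IsMarkovKernel (kernel t)

attribute [instance] Policy.markov

/-- The deterministic stationary policy `U_t = γ (X_t)`. -/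
def Policy.stationary {X U : Type*} [MeasurableSpace X] [MeasurableSpace U]
    (γ : X → U) (hγ : Measurable γ) : Policy X U where
  kernel _ := Kernel.deterministic (fun p => γ p.2) (hγ.comp measurable_snd)
  markov _ := inferInstance

section Dynamics

variable {X U : Type*} [MeasurableSpace X] [MeasurableSpace U]

/-- The joint law of `(X_0, U_0)` when `X_0 = x`. -/
def initLaw (π : Policy X U) (x : X) : Measure (X × U) :=
  (Measure.dirac x).compProd
    ((π.kernel 0).comap (fun y : X => ((Fin.elim0 : Fin 0 → X × U), y)) (by fun_prop))

instance (π : Policy X U) (x : X) : IsProbabilityMeasure (initLaw π x) := by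
  unfold initLaw; infer_instance

/-- The conditional law of `(X_{n+1}, U_{n+1})` given `(X_0, U_0), …, (X_n, U_n)`: the state is drawn
from `T (· | X_n, U_n)`, and then the action from the policy at the history of time `n + 1`. -/
def stepKernel (T : Kernel (X × U) X) (π : Policy X U) (n : ℕ) :
    Kernel (∀ _ : Finset.Iic n, X × U) (X × U) :=
  (T.comap (fun y : (∀ _ : Finset.Iic n, X × U) => y ⟨n, Finset.mem_Iic.2 le_rfl⟩)
      (by fun_prop)).compProd
    ((π.kernel (n + 1)).comap
      (fun p : (∀ _ : Finset.Iic n, X × U) × X =>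
        ((fun i : Fin (n + 1) => p.1 ⟨i, Finset.mem_Iic.2 (Nat.lt_succ_iff.1 i.2)⟩), p.2))
      (by fun_prop))

instance (T : Kernel (X × U) X) [IsMarkovKernel T] (π : Policy X U) (n : ℕ) :
    IsMarkovKernel (stepKernel T π n) := by
  unfold stepKernel; infer_instance

/-- The law of the process `(X_t, U_t)_{t ≥ 0}` under the controlled transition kernel `T` and the
policy `π`, started at `X_0 = x`. -/
def law (T : Kernel (X × U) X) [IsMarkovKernel T] (π : Policy X U) (x : X) :
    Measure (ℕ → X × U) :=
  Kernel.trajMeasure (X := fun _ => X × U) (initLaw π x) (stepKernel T π)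

/-- The long-run average cost `limsup_N N⁻¹ E[∑_{t < N} c (X_t, U_t) | X_0 = x]`. -/
def avgCost (c : X × U → ℝ) (T : Kernel (X × U) X) [IsMarkovKernel T] (π : Policy X U) (x : X) :
    ℝ :=
  limsup (fun N : ℕ => (1 / (N : ℝ)) * ∫ ω, ∑ t ∈ Finset.range N, c (ω t) ∂(law T π x)) atTop

/-- The optimal average cost, the infimum being over all admissible policies. -/
def optAvgCost (c : X × U → ℝ) (T : Kernel (X × U) X) [IsMarkovKernel T] (x : X) : ℝ :=
  ⨅ π : Policy X U, avgCost c T π x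

/-- The discrepancy `d_f (μ, ν) = |∫ f dμ - ∫ f dν|`. -/
def disc (f : X → ℝ) (μ ν : Measure X) : ℝ := |∫ y, f y ∂μ - ∫ y, f y ∂ν|

/-- The discrepancy `d_f (T, S) = sup_{x, u} d_f (T (· | x, u), S (· | x, u))`. -/
def kernelDisc (f : X → ℝ) (T S : Kernel (X × U) X) : ℝ := ⨆ z : X × U, disc f (T z) (S z)

/-- The supremum norm of a (bounded) function. -/
def supNorm {Z : Type*} (f : Z → ℝ) : ℝ := ⨆ z : Z, |f z|

/-- The minorization condition `T (A | x, u) ≥ ε ρ (A)`. -/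
def Minorized (T : Kernel (X × U) X) (ρ : Measure X) (ε : ℝ) : Prop :=
  ∀ (x : X) (u : U) (A : Set X), MeasurableSet A → ENNReal.ofReal ε * ρ A ≤ T (x, u) A

/-- The minorized Bellman operator
`v ↦ inf_u {c (x, u) + ∫ v(y) (T (dy | x, u) - ε ρ (dy))}`. -/
def minorizedBellman (c : X × U → ℝ) (T : Kernel (X × U) X) (ρ : Measure X) (ε : ℝ)
    (v : X → ℝ) (x : X) : ℝ :=
  ⨅ u : U, (c (x, u) + (∫ y, v y ∂(T (x, u)) - ε * ∫ y, v y ∂ρ))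

end Dynamics

section Equations

variable {X U : Type*} [TopologicalSpace X] [MeasurableSpace X]
  [TopologicalSpace U] [MeasurableSpace U]

/-- The regularity conditions on the cost and the transition kernel (the compactness of the action
space is assumed separately). -/
structure Regular (c : X × U → ℝ) (T : Kernel (X × U) X) : Prop where
  nonneg : ∀ z, 0 ≤ c z
  bounded : ∃ M : ℝ, ∀ z, |c z| ≤ M
  continuous : Continuous c
  weaklyContinuous : ∀ v : X →ᵇ ℝ, Continuous (fun z : X × U => ∫ y, v y ∂(T z))

/-- `h ∈ C_b(X)` is a fixed point of the minorized Bellman operator. -/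
def IsMinorizedFixedPoint (c : X × U → ℝ) (T : Kernel (X × U) X) (ρ : Measure X) (ε : ℝ)
    (h : X →ᵇ ℝ) : Prop :=
  ∀ x, minorizedBellman c T ρ ε h x = h x

/-- `(g, h, γ)` is a canonical triplet: `(g, h)` solves the average cost optimality equation and
`γ` attains the minimum in it at every state. -/
def IsCanonicalTriplet (c : X × U → ℝ) (T : Kernel (X × U) X) (g : ℝ) (h : X →ᵇ ℝ) (γ : X → U) :
    Prop :=
  (∀ x, g + h x = ⨅ u : U, (c (x, u) + ∫ y, h y ∂(T (x, u)))) ∧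
    ∀ x, g + h x = c (x, γ x) + ∫ y, h y ∂(T (x, γ x))

end Equations

end

end MDP

namespace MDP

/-! ### One-step marginals of the controlled process. -/

section Trajectories

variable {X U : Type*} [MeasurableSpace X] [MeasurableSpace U]

/-! Minorization makes `T - ερ` a nonnegative kernel of mass `1 - ε`, so the minorized Bellman
operator is a contraction of `C_b(X)`. Since the `ρ`-term does not depend on the action, its fixed
point `h` solves the average cost optimality equation with gain `ε ∫ h dρ`. Telescoping along
trajectories (`le_avgCost`, `avgCost_stationary_le`) turns sub- and supersolutions of that equation
into bounds on average costs.

A canonical triplet for `(c', S)` can be shifted by a constant so that its function `k` is the fixed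
point for `(c', S, τ)`. Let `D` be the cost distance plus `d_h(T, S)`. Comparing both operators at
`h` alone gives `ε‖k - h‖ ≤ D + ε d_h(ρ, τ)` (`norm_sub_le_of_isMinorizedFixedPoint`). Hence only
discrepancies tested on `h` occur. Replacing `k` by `h` in the equation attained by `γ` makes `h` a
supersolution for `(c, T)` under `γ`, with excess gain at most `(2/ε)(D + ε d_h(ρ, τ))`
(`IsCanonicalTriplet.cost_add_integral_le`). -/

instance (T : Kernel (X × U) X) [IsMarkovKernel T] (π : Policy X U) (x : X) :
    IsProbabilityMeasure (law T π x) := by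
  unfold law; infer_instance

lemma measurable_eval (n : ℕ) : Measurable (fun ω : ℕ → X × U => ω n) :=
  measurable_pi_apply n

lemma law_map_zero (T : Kernel (X × U) X) [IsMarkovKernel T] (π : Policy X U) (x : X) :
    (law T π x).map (fun ω => ω 0) = initLaw π x := by
  have hcomp : (fun ω : ℕ → X × U => ω 0) =
      (fun y : (∀ _ : Finset.Iic 0, X × U) => y ⟨0, Finset.mem_Iic.2 le_rfl⟩) ∘
        Preorder.frestrictLe 0 := rfl
  rw [law, Kernel.trajMeasure, Measure.map_comp _ _ (measurable_pi_apply 0), hcomp,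
    Kernel.map_comp_right _ (Preorder.measurable_frestrictLe 0) (measurable_pi_apply _),
    Kernel.traj_map_frestrictLe_of_le le_rfl, Kernel.deterministic_map _ (measurable_pi_apply _),
    Measure.deterministic_comp_eq_map]
  have hm : Measurable ((fun y : (∀ _ : Finset.Iic 0, X × U) => y ⟨0, Finset.mem_Iic.2 le_rfl⟩) ∘
      Preorder.frestrictLe₂ (π := fun _ => X × U) (le_refl 0)) :=
    (measurable_pi_apply _).comp (Preorder.measurable_frestrictLe₂ _)
  -- The initial law is transported to one-point families and evaluated back: the composite is the
  -- identity.
  exact (Measure.map_map (g := _) hm (MeasurableEquiv.measurable _)).trans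
    (Measure.map_id (μ := initLaw π x))

lemma law_map_succ (T : Kernel (X × U) X) [IsMarkovKernel T] (π : Policy X U) (x : X) (n : ℕ) :
    (law T π x).map (fun ω => (Preorder.frestrictLe n ω, ω (n + 1))) =
      (law T π x).map (Preorder.frestrictLe n) ⊗ₘ stepKernel T π n :=
  Kernel.map_frestrictLe_trajMeasure_compProd_eq_map_trajMeasure.symm

lemma stepKernel_map_fst (T : Kernel (X × U) X) [IsMarkovKernel T] (π : Policy X U) (n : ℕ)
    (y : ∀ _ : Finset.Iic n, X × U) :
    (stepKernel T π n y).map Prod.fst = T (y ⟨n, Finset.mem_Iic.2 le_rfl⟩) := by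
  rw [← Kernel.map_apply _ measurable_fst, ← Kernel.fst_eq, stepKernel, Kernel.fst_compProd,
    Kernel.comap_apply]

lemma integrable_of_abs_le {Ω : Type*} [MeasurableSpace Ω] {μ : Measure Ω} [IsFiniteMeasure μ]
    {f : Ω → ℝ} (hf : Measurable f) {M : ℝ} (hM : ∀ z, |f z| ≤ M) : Integrable f μ :=
  Integrable.of_bound hf.aestronglyMeasurable M (ae_of_all _ hM)

lemma integral_law_zero (T : Kernel (X × U) X) [IsMarkovKernel T] (π : Policy X U) (x : X)
    {f : X → ℝ} (hf : Measurable f) :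
    ∫ ω, f (ω 0).1 ∂(law T π x) = f x := by
  have h1 : (law T π x).map (fun ω => (ω 0).1) = Measure.dirac x := by
    have : (fun ω : ℕ → X × U => (ω 0).1) = Prod.fst ∘ fun ω => ω 0 := rfl
    rw [this, ← Measure.map_map measurable_fst (measurable_pi_apply 0), law_map_zero, initLaw]
    exact Measure.fst_compProd _ _
  rw [← integral_map (φ := fun ω : ℕ → X × U => (ω 0).1)
    (measurable_fst.comp (measurable_pi_apply 0)).aemeasurable
    hf.aestronglyMeasurable, h1, integral_dirac' _ _ hf.stronglyMeasurable]

/-- The policy only draws the action after the new state, so it drops out of the state marginal of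
`stepKernel`; this is the Markov property needed for telescoping. -/
lemma integral_law_succ (T : Kernel (X × U) X) [IsMarkovKernel T] (π : Policy X U) (x : X) (n : ℕ)
    {f : X → ℝ} (hf : Measurable f) {M : ℝ} (hM : ∀ y, |f y| ≤ M) :
    ∫ ω, f (ω (n + 1)).1 ∂(law T π x) = ∫ ω, ∫ y, f y ∂(T (ω n)) ∂(law T π x) := by
  have hF : Measurable (fun p : (∀ _ : Finset.Iic n, X × U) × (X × U) => f p.2.1) := by fun_prop
  have h1 := integral_map (μ := law T π x)
    (φ := fun ω => (Preorder.frestrictLe (π := fun _ => X × U) n ω, ω (n + 1)))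
    (by fun_prop) hF.aestronglyMeasurable
  rw [law_map_succ, Measure.integral_compProd (integrable_of_abs_le hF fun p => hM _)] at h1
  rw [← h1]
  have h2 : ∀ y : ∀ _ : Finset.Iic n, X × U, ∫ b, f b.1 ∂(stepKernel T π n y) =
      ∫ b, f b ∂(T (y ⟨n, Finset.mem_Iic.2 le_rfl⟩)) := by
    intro y
    rw [← stepKernel_map_fst T π n y, integral_map (by fun_prop) hf.aestronglyMeasurable]
  simp_rw [h2]
  have hI : StronglyMeasurable (fun z : X × U => ∫ b, f b ∂(T z)) :=
    StronglyMeasurable.integral_kernel hf.stronglyMeasurable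
  rw [integral_map (by fun_prop)]
  · rfl
  · exact (hI.comp_measurable (by fun_prop)).aestronglyMeasurable

lemma ae_law_stationary [TopologicalSpace U] [PolishSpace U] [BorelSpace U]
    (T : Kernel (X × U) X) [IsMarkovKernel T] {γ : X → U} (hγ : Measurable γ) (x : X) (n : ℕ) :
    ∀ᵐ ω ∂(law T (Policy.stationary γ hγ) x), (ω n).2 = γ (ω n).1 := by
  have hs : MeasurableSet {z : X × U | z.2 = γ z.1} :=
    measurableSet_eq_fun measurable_snd (hγ.comp measurable_fst)
  cases n with
  | zero =>
    have h : ∀ᵐ z ∂(initLaw (Policy.stationary γ hγ) x), z.2 = γ z.1 := by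
      rw [initLaw, Measure.ae_compProd_iff hs]
      refine ae_of_all _ fun y => ?_
      simp only [Policy.stationary, Kernel.comap_apply, Kernel.deterministic_apply]
      exact (ae_dirac_iff (measurableSet_eq_fun measurable_id measurable_const)).2 rfl
    rw [← law_map_zero T, ae_map_iff (measurable_eval 0).aemeasurable hs] at h
    exact h
  | succ n =>
    have hs' : MeasurableSet {p : (∀ _ : Finset.Iic n, X × U) × (X × U) | p.2.2 = γ p.2.1} :=
      measurable_snd hs
    have h : ∀ᵐ p ∂((law T (Policy.stationary γ hγ) x).map (Preorder.frestrictLe n) ⊗ₘ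
        stepKernel T (Policy.stationary γ hγ) n), p.2.2 = γ p.2.1 := by
      rw [Measure.ae_compProd_iff hs']
      refine ae_of_all _ fun y => ?_
      rw [stepKernel, Kernel.ae_compProd_iff hs]
      refine ae_of_all _ fun b => ?_
      simp only [Policy.stationary, Kernel.comap_apply, Kernel.deterministic_apply]
      exact (ae_dirac_iff (measurableSet_eq_fun measurable_id measurable_const)).2 rfl
    rw [← law_map_succ, ae_map_iff (by fun_prop) hs'] at h
    exact h

end Trajectories

/-! ### Verification bounds for the average cost. -/

section AverageCost

lemma tendsto_sub_div_natCast (g K : ℝ) :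
    Tendsto (fun N : ℕ => g - K / (N : ℝ)) atTop (nhds g) := by
  simpa using (tendsto_const_nhds (x := g)).sub (tendsto_const_div_atTop_nhds_zero_nat K)

/-- The bound by `M` serves only to keep the real-valued `limsup` from taking its default value;
`h0` has the same role in `limsup_average_le`. -/
lemma le_limsup_average {s : ℕ → ℝ} {g K M : ℝ} (hg : ∀ N : ℕ, N * g - K ≤ s N)
    (hM : ∀ N : ℕ, s N ≤ N * M) : g ≤ limsup (fun N : ℕ => (1 / (N : ℝ)) * s N) atTop := by
  have ht := tendsto_sub_div_natCast g K
  rw [← ht.limsup_eq]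
  refine limsup_le_limsup ?_ ht.isCoboundedUnder_le ?_
  · filter_upwards [eventually_gt_atTop 0] with N hN
    have hN' : (0 : ℝ) < N := by exact_mod_cast hN
    have := hg N
    rw [one_div, inv_mul_eq_div, le_div_iff₀ hN']
    field_simp
    linarith
  · refine isBoundedUnder_of_eventually_le (a := M) ?_
    filter_upwards [eventually_gt_atTop 0] with N hN
    have hN' : (0 : ℝ) < N := by exact_mod_cast hN
    rw [one_div, inv_mul_eq_div, div_le_iff₀ hN', mul_comm]
    exact hM N

lemma limsup_average_le {s : ℕ → ℝ} {g K : ℝ} (hg : ∀ N : ℕ, s N ≤ N * g + K)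
    (h0 : ∀ N : ℕ, 0 ≤ s N) : limsup (fun N : ℕ => (1 / (N : ℝ)) * s N) atTop ≤ g := by
  have ht := tendsto_sub_div_natCast g (-K)
  rw [← ht.limsup_eq]
  refine limsup_le_limsup ?_ ?_ ht.isBoundedUnder_le
  · filter_upwards [eventually_gt_atTop 0] with N hN
    have hN' : (0 : ℝ) < N := by exact_mod_cast hN
    have := hg N
    rw [one_div, inv_mul_eq_div, div_le_iff₀ hN']
    field_simp
    linarith
  · exact (isBoundedUnder_of_eventually_ge (a := 0)
      (Eventually.of_forall fun N => mul_nonneg (by positivity) (h0 N))).isCoboundedUnder_le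

lemma integral_const_add_of_prob {Ω : Type*} [MeasurableSpace Ω] {μ : Measure Ω}
    [IsProbabilityMeasure μ] {f : Ω → ℝ} (hf : Integrable f μ) (g : ℝ) :
    ∫ z, (g + f z) ∂μ = g + ∫ z, f z ∂μ := by
  rw [integral_add (integrable_const g) hf]; simp

variable {X U : Type*} [MeasurableSpace X] [MeasurableSpace U]
  {T : Kernel (X × U) X} [IsMarkovKernel T] {c : X × U → ℝ} {h : X → ℝ} {g M K : ℝ}

lemma integral_sum_law (hc : Measurable c) (hM : ∀ z, |c z| ≤ M) (π : Policy X U) (x : X) (N : ℕ) :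
    ∫ ω, ∑ t ∈ Finset.range N, c (ω t) ∂(law T π x) =
      ∑ t ∈ Finset.range N, ∫ ω, c (ω t) ∂(law T π x) :=
  integral_finsetSum _ fun t _ => integrable_of_abs_le (by fun_prop) fun ω => hM _

lemma abs_integral_le_of_abs_le {Ω : Type*} [MeasurableSpace Ω] {μ : Measure Ω}
    [IsProbabilityMeasure μ] {f : Ω → ℝ} (hM : ∀ z, |f z| ≤ M) : |∫ z, f z ∂μ| ≤ M := by
  simpa using norm_integral_le_of_norm_le_const (f := f) (μ := μ) (ae_of_all _ hM)

lemma measurable_integral_kernel (T : Kernel (X × U) X) [IsMarkovKernel T] (hh : Measurable h) :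
    Measurable (fun z : X × U => ∫ y, h y ∂(T z)) :=
  (StronglyMeasurable.integral_kernel hh.stronglyMeasurable).measurable

lemma integrable_law_potential (hc : Measurable c) (hM : ∀ z, |c z| ≤ M)
    (hh : Measurable h) (hK : ∀ y, |h y| ≤ K) (π : Policy X U) (x : X) (t : ℕ) :
    Integrable (fun ω => c (ω t)) (law T π x) ∧ Integrable (fun ω => h (ω t).1) (law T π x) ∧
      Integrable (fun ω => ∫ y, h y ∂(T (ω t))) (law T π x) :=
  ⟨integrable_of_abs_le (by fun_prop) fun ω => hM _,
    integrable_of_abs_le (by fun_prop) fun ω => hK _,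
    integrable_of_abs_le ((measurable_integral_kernel T hh).comp (measurable_pi_apply t))
      fun ω => abs_integral_le_of_abs_le hK⟩

/-- A subsolution of the average cost optimality equation bounds the cost of every policy from
below. -/
lemma le_avgCost (hc : Measurable c) (hM : ∀ z, |c z| ≤ M)
    (hh : Measurable h) (hK : ∀ y, |h y| ≤ K)
    (hle : ∀ z : X × U, g + h z.1 ≤ c z + ∫ y, h y ∂(T z)) (π : Policy X U) (x : X) :
    g ≤ avgCost c T π x := by
  have hstep : ∀ t, g + ∫ ω, h (ω t).1 ∂(law T π x) ≤
      ∫ ω, c (ω t) ∂(law T π x) + ∫ ω, h (ω (t + 1)).1 ∂(law T π x) := by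
    intro t
    obtain ⟨i1, i2, i3⟩ := integrable_law_potential (T := T) hc hM hh hK π x t
    rw [integral_law_succ T π x t hh hK, ← integral_add i1 i3]
    have := integral_mono (g := fun ω : ℕ → X × U => c (ω t) + ∫ y, h y ∂(T (ω t)))
      (f := fun ω : ℕ → X × U => g + h (ω t).1) ((integrable_const g).add i2)
      (i1.add i3) fun ω => hle (ω t)
    rw [integral_const_add_of_prob i2] at this
    exact this
  have hsum : ∀ N : ℕ, N * g + h x ≤
      ∑ t ∈ Finset.range N, ∫ ω, c (ω t) ∂(law T π x) + ∫ ω, h (ω N).1 ∂(law T π x) := by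
    intro N
    induction N with
    | zero => simp [integral_law_zero T π x hh]
    | succ N ih =>
      rw [Finset.sum_range_succ]
      push_cast
      linarith [hstep N]
  -- After telescoping only the two boundary values of `h` remain, each at most `K` in size.
  refine le_limsup_average (K := 2 * K) (M := M) (fun N => ?_) (fun N => ?_)
  · rw [integral_sum_law hc hM]
    have h1 : |∫ ω, h (ω N).1 ∂(law T π x)| ≤ K := abs_integral_le_of_abs_le fun ω => hK _
    linarith [hsum N, (abs_le.1 h1).2, (abs_le.1 (hK x)).1]
  · rw [integral_sum_law hc hM]
    refine (Finset.sum_le_card_nsmul _ _ M fun t _ => ?_).trans (by simp)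
    exact (abs_le.1 (abs_integral_le_of_abs_le fun ω : ℕ → X × U => hM (ω t))).2

/-- A supersolution of the average cost equation of a stationary policy bounds its cost from
above. -/
lemma avgCost_stationary_le [TopologicalSpace U] [PolishSpace U] [BorelSpace U]
    (hc : Measurable c) (hM : ∀ z, |c z| ≤ M) (h0 : ∀ z, 0 ≤ c z)
    (hh : Measurable h) (hK : ∀ y, |h y| ≤ K) {γ : X → U} (hγ : Measurable γ)
    (hle : ∀ x, c (x, γ x) + ∫ y, h y ∂(T (x, γ x)) ≤ g + h x) (x : X) :
    avgCost c T (Policy.stationary γ hγ) x ≤ g := by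
  set π := Policy.stationary γ hγ
  have hstep : ∀ t, ∫ ω, c (ω t) ∂(law T π x) + ∫ ω, h (ω (t + 1)).1 ∂(law T π x) ≤
      g + ∫ ω, h (ω t).1 ∂(law T π x) := by
    intro t
    obtain ⟨i1, i2, i3⟩ := integrable_law_potential (T := T) hc hM hh hK π x t
    rw [integral_law_succ T π x t hh hK, ← integral_add i1 i3]
    have := integral_mono_ae (f := fun ω : ℕ → X × U => c (ω t) + ∫ y, h y ∂(T (ω t)))
      (g := fun ω : ℕ → X × U => g + h (ω t).1) (i1.add i3) ((integrable_const g).add i2) (by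
      filter_upwards [ae_law_stationary T hγ x t] with ω hω
      have e : ω t = ((ω t).1, γ (ω t).1) := Prod.ext rfl hω
      have := hle (ω t).1
      rw [← e] at this
      exact this)
    rw [integral_const_add_of_prob i2] at this
    exact this
  have hsum : ∀ N : ℕ,
      ∑ t ∈ Finset.range N, ∫ ω, c (ω t) ∂(law T π x) + ∫ ω, h (ω N).1 ∂(law T π x) ≤
        N * g + h x := by
    intro N
    induction N with
    | zero => simp [integral_law_zero T π x hh]
    | succ N ih =>
      rw [Finset.sum_range_succ]
      push_cast
      linarith [hstep N]
  refine limsup_average_le (K := 2 * K) (fun N => ?_) (fun N => ?_)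
  · rw [integral_sum_law hc hM]
    have h1 : |∫ ω, h (ω N).1 ∂(law T π x)| ≤ K := abs_integral_le_of_abs_le fun ω => hK _
    linarith [hsum N, (abs_le.1 h1).1, (abs_le.1 (hK x)).2]
  · exact integral_nonneg fun ω => Finset.sum_nonneg fun t _ => h0 _

end AverageCost

end MDP
namespace MDP

/-! ### Minimization over a compact action space. -/

section Compact

variable {X U : Type*} [TopologicalSpace X] [TopologicalSpace U] [CompactSpace U] [Nonempty U]

lemma exists_eq_iInf_of_continuous {f : U → ℝ} (hf : Continuous f) :
    ∃ u, f u = ⨅ u, f u ∧ ∀ v, f u ≤ f v := by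
  obtain ⟨u, -, hu⟩ := isCompact_univ.exists_isMinOn Set.univ_nonempty hf.continuousOn
  have hu' : ∀ v, f u ≤ f v := fun v => hu (Set.mem_univ v)
  exact ⟨u, le_antisymm (le_ciInf hu') (ciInf_le ⟨f u, Set.forall_mem_range.2 hu'⟩ u), hu'⟩

omit [Nonempty U] in
lemma continuous_iInf_of_compactSpace {F : X × U → ℝ} (hF : Continuous F) :
    Continuous fun x => ⨅ u, F (x, u) := by
  have := isCompact_univ.continuous_sInf (f := fun x u => F (x, u)) (K := (Set.univ : Set U)) hF
  simpa only [Set.image_univ, sInf_range] using this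

lemma iInf_le_of_continuous {f : U → ℝ} (hf : Continuous f) (u : U) : ⨅ u, f u ≤ f u := by
  obtain ⟨u₀, h, h'⟩ := exists_eq_iInf_of_continuous hf
  exact h ▸ h' u

lemma abs_iInf_sub_iInf_le {f g : U → ℝ} (hf : Continuous f) (hg : Continuous g) {K : ℝ}
    (h : ∀ u, |f u - g u| ≤ K) : |(⨅ u, f u) - ⨅ u, g u| ≤ K := by
  obtain ⟨u, hu, -⟩ := exists_eq_iInf_of_continuous hf
  obtain ⟨v, hv, -⟩ := exists_eq_iInf_of_continuous hg
  have h1 := iInf_le_of_continuous hf v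
  have h2 := iInf_le_of_continuous hg u
  rw [abs_le]
  constructor <;> linarith [(abs_le.1 (h u)).1, (abs_le.1 (h v)).2]

/-- A jointly continuous function on `X × U` with `U` compact metrizable has a measurable selection
of minimizers over `U`. The compact set `U` is parametrized by a compact set of real numbers, and
the least parameter of a minimizer depends lower semicontinuously on `x`. -/
lemma exists_measurable_argmin [MeasurableSpace X] [BorelSpace X]
    [TopologicalSpace.MetrizableSpace U] [MeasurableSpace U] [BorelSpace U] {F : X × U → ℝ}
    (hF : Continuous F) :
    ∃ γ : X → U, Measurable γ ∧ ∀ x, F (x, γ x) = ⨅ u, F (x, u) := by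
  let _ := TopologicalSpace.metrizableSpaceMetric U
  obtain ⟨φ₀, hφ₀, hφ₀s⟩ := exists_nat_bool_continuous_surjective_of_compact U
  let φ : cantorSet → U := φ₀ ∘ cantorSetHomeomorphNatToBool
  have hφ : Continuous φ := hφ₀.comp cantorSetHomeomorphNatToBool.continuous
  have hφs : Function.Surjective φ := hφ₀s.comp cantorSetHomeomorphNatToBool.surjective
  have : CompactSpace cantorSet := isCompact_iff_compactSpace.1 isCompact_cantorSet
  let G : Set (X × cantorSet) := {p | F (p.1, φ p.2) = ⨅ u, F (p.1, u)}
  have hG : IsClosed G := isClosed_eq (by fun_prop)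
    ((continuous_iInf_of_compactSpace hF).comp continuous_fst)
  have hmin : ∀ x, ∃ k : cantorSet, (x, k) ∈ G ∧ ∀ k', (x, k') ∈ G → k ≤ k' := by
    intro x
    have hc : IsCompact {k | (x, k) ∈ G} :=
      (hG.preimage (Continuous.prodMk_right x)).isCompact
    have hne : {k | (x, k) ∈ G}.Nonempty := by
      obtain ⟨u, hu, -⟩ := exists_eq_iInf_of_continuous (f := fun u => F (x, u)) (by fun_prop)
      obtain ⟨k, rfl⟩ := hφs u
      exact ⟨k, hu⟩
    obtain ⟨k, hk, hk'⟩ := hc.exists_isLeast hne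
    exact ⟨k, hk, fun k' h => hk' h⟩
  choose m hmG hmle using hmin
  have hm : Measurable m := by
    refine Measurable.subtype_mk (f := fun x => (m x : ℝ)) (measurable_of_Iic fun a => ?_)
    -- As `m x` is the least minimizing parameter, it is at most `a` as soon as some minimizing
    -- parameter is. Projection along the compact factor keeps this set closed.
    have : (fun x => (m x : ℝ)) ⁻¹' Set.Iic a = Prod.fst '' (G ∩ {p | (p.2 : ℝ) ≤ a}) := by
      ext x
      constructor
      · exact fun h => ⟨(x, m x), ⟨hmG x, h⟩, rfl⟩
      · rintro ⟨⟨y, k⟩, ⟨hk, hka⟩, rfl⟩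
        exact (Subtype.coe_le_coe.2 (hmle y k hk)).trans hka
    rw [this]
    exact (isClosedMap_fst_of_compactSpace _
      (hG.inter (isClosed_le (by fun_prop) continuous_const))).measurableSet
  exact ⟨φ ∘ m, hφ.measurable.comp hm, hmG⟩

end Compact

/-! ### Consequences of the minorization condition. -/

section Minorization

variable {X U : Type*} [MeasurableSpace X] [MeasurableSpace U] {T : Kernel (X × U) X}
  [IsMarkovKernel T] {ρ : Measure X} [IsProbabilityMeasure ρ] {ε : ℝ}

lemma Minorized.le_one [Nonempty U] (h : Minorized T ρ ε) : ε ≤ 1 := by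
  obtain ⟨x⟩ := nonempty_of_isProbabilityMeasure ρ
  obtain ⟨u⟩ := ‹Nonempty U›
  simpa using h x u Set.univ MeasurableSet.univ

omit [IsMarkovKernel T] [IsProbabilityMeasure ρ] in
lemma Minorized.mul_integral_le (hε : 0 < ε) (h : Minorized T ρ ε) (z : X × U) {f : X → ℝ}
    (hf0 : ∀ y, 0 ≤ f y) (hf : Integrable f (T z)) : ε * ∫ y, f y ∂ρ ≤ ∫ y, f y ∂(T z) := by
  have hle : ENNReal.ofReal ε • ρ ≤ T z := Measure.le_iff.2 fun A hA => by
    simpa using h z.1 z.2 A hA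
  have := integral_mono_measure hle (ae_of_all _ hf0) hf
  rwa [integral_smul_measure, ENNReal.toReal_ofReal hε.le, smul_eq_mul] at this

/-- Integration against `T (· | x, u) - ε ρ` contracts the supremum norm by the factor `1 - ε`. -/
lemma Minorized.abs_integral_sub_le (hε : 0 < ε) (h : Minorized T ρ ε) (z : X × U) {f : X → ℝ}
    (hf : Measurable f) {K : ℝ} (hK : ∀ y, |f y| ≤ K) :
    |∫ y, f y ∂(T z) - ε * ∫ y, f y ∂ρ| ≤ (1 - ε) * K := by
  have iT : Integrable f (T z) := integrable_of_abs_le hf hK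
  have iρ : Integrable f ρ := integrable_of_abs_le hf hK
  -- Testing the nonnegative measure `T z - ερ`, of mass `1 - ε`, on `K - f` and `K + f` gives the
  -- two one-sided bounds.
  have h1 := h.mul_integral_le hε z (f := fun y => K - f y)
    (fun y => sub_nonneg.2 (abs_le.1 (hK y)).2) ((integrable_const K).sub iT)
  have h2 := h.mul_integral_le hε z (f := fun y => K + f y)
    (fun y => by linarith [(abs_le.1 (hK y)).1]) ((integrable_const K).add iT)
  rw [integral_sub (integrable_const K) iT, integral_sub (integrable_const K) iρ] at h1
  rw [integral_const_add_of_prob iT, integral_const_add_of_prob iρ] at h2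
  simp only [integral_const, probReal_univ, one_smul] at h1
  rw [abs_le]
  constructor <;> linarith

end Minorization

/-! ### The minorized Bellman operator, its fixed point and stability. -/

section Bellman

lemma abs_sub_le_supNorm {Z : Type*} {c c' : Z → ℝ} {M M' : ℝ} (hM : ∀ z, |c z| ≤ M)
    (hM' : ∀ z, |c' z| ≤ M') (z : Z) : |c z - c' z| ≤ supNorm fun z => c z - c' z :=
  le_ciSup (f := fun z => |c z - c' z|) ⟨M + M', Set.forall_mem_range.2 fun z =>
    (abs_sub _ _).trans (add_le_add (hM z) (hM' z))⟩ z

variable {X U : Type*} [TopologicalSpace X] [MeasurableSpace X] [BorelSpace X]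
  [TopologicalSpace U] [CompactSpace U] [Nonempty U] [MeasurableSpace U]
  {T S : Kernel (X × U) X} [IsMarkovKernel T] [IsMarkovKernel S] {c c' : X × U → ℝ}
  {ρ τ : Measure X} [IsProbabilityMeasure ρ] [IsProbabilityMeasure τ] {ε : ℝ}

omit [MeasurableSpace X] [BorelSpace X] in
lemma abs_le_norm_boundedContinuousFunction (f : X →ᵇ ℝ) (x : X) : |f x| ≤ ‖f‖ :=
  f.norm_coe_le_norm x

lemma integrable_boundedContinuousFunction (f : X →ᵇ ℝ) (μ : Measure X) [IsFiniteMeasure μ] :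
    Integrable f μ :=
  integrable_of_abs_le f.continuous.measurable (abs_le_norm_boundedContinuousFunction f)

omit [BorelSpace X] [CompactSpace U] [Nonempty U] [IsMarkovKernel T] in
lemma Regular.continuous_cost_add (hT : Regular c T) (v : X →ᵇ ℝ) (a : ℝ) :
    Continuous fun z : X × U => c z + (∫ y, v y ∂(T z) - a) :=
  hT.continuous.add ((hT.weaklyContinuous v).sub continuous_const)

/-- The minorized Bellman operator on bounded continuous functions. -/
noncomputable def bellmanMap (hT : Regular c T) (ρ : Measure X) [IsProbabilityMeasure ρ] (ε : ℝ)
    (v : X →ᵇ ℝ) : X →ᵇ ℝ :=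
  BoundedContinuousFunction.ofNormedAddCommGroup (minorizedBellman c T ρ ε v)
    (continuous_iInf_of_compactSpace (hT.continuous_cost_add v _))
    (hT.bounded.choose + (‖v‖ + |ε * ∫ y, v y ∂ρ|)) (by
      intro x
      obtain ⟨u, hu, -⟩ := exists_eq_iInf_of_continuous
        (f := fun u => c (x, u) + (∫ y, v y ∂(T (x, u)) - ε * ∫ y, v y ∂ρ))
        ((hT.continuous_cost_add v _).comp (Continuous.prodMk_right x))
      rw [minorizedBellman, ← hu, Real.norm_eq_abs]
      refine (abs_add_le _ _).trans (add_le_add (hT.bounded.choose_spec _) ?_)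
      exact (abs_sub _ _).trans (add_le_add_left
        (abs_integral_le_of_abs_le (abs_le_norm_boundedContinuousFunction v)) _))

/-- For a fixed action the difference is the integral of `v - w` against `T - ερ`, and taking infima
over actions does not increase uniform distances. -/
lemma Minorized.abs_minorizedBellman_sub_le (hε : 0 < ε) (h : Minorized T ρ ε)
    (hT : Regular c T) (v w : X →ᵇ ℝ) (x : X) :
    |minorizedBellman c T ρ ε v x - minorizedBellman c T ρ ε w x| ≤ (1 - ε) * ‖v - w‖ := by
  refine abs_iInf_sub_iInf_le ((hT.continuous_cost_add v _).comp (Continuous.prodMk_right x))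
    ((hT.continuous_cost_add w _).comp (Continuous.prodMk_right x)) fun u => ?_
  have := h.abs_integral_sub_le hε (x, u) (v - w).continuous.measurable
    (abs_le_norm_boundedContinuousFunction (v - w))
  simp only [BoundedContinuousFunction.coe_sub, Pi.sub_apply] at this
  rw [integral_sub (integrable_boundedContinuousFunction v _)
      (integrable_boundedContinuousFunction w _),
    integral_sub (integrable_boundedContinuousFunction v _)
      (integrable_boundedContinuousFunction w _)] at this
  convert this using 2
  simp only [Function.comp_apply]
  ring

lemma existsUnique_isMinorizedFixedPoint (hε : 0 < ε) (h : Minorized T ρ ε) (hT : Regular c T) :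
    ∃! v : X →ᵇ ℝ, IsMinorizedFixedPoint c T ρ ε v := by
  have hε1 := h.le_one
  have hcontr : ContractingWith (1 - ε).toNNReal (bellmanMap hT ρ ε) := by
    refine ⟨by rw [← NNReal.coe_lt_coe, Real.coe_toNNReal _ (by linarith)]; simpa using hε,
      LipschitzWith.of_dist_le_mul fun v w => ?_⟩
    rw [Real.coe_toNNReal _ (by linarith), dist_eq_norm, dist_eq_norm]
    refine (BoundedContinuousFunction.norm_le
      (mul_nonneg (by linarith) (norm_nonneg _))).2 fun x => ?_
    exact h.abs_minorizedBellman_sub_le hε hT v w x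
  refine ⟨hcontr.fixedPoint _, fun x => ?_, fun v hv => ?_⟩
  · exact DFunLike.congr_fun hcontr.fixedPoint_isFixedPt x
  · exact hcontr.fixedPoint_unique (BoundedContinuousFunction.ext hv)

omit [BorelSpace X] [IsMarkovKernel T] [IsProbabilityMeasure ρ] in
-- The bridge between fixed points and the optimality equation: the constant pulled out of the
-- infimum becomes the gain.
lemma minorizedBellman_eq (hT : Regular c T) (v : X →ᵇ ℝ) (x : X) :
    minorizedBellman c T ρ ε v x =
      (⨅ u, (c (x, u) + ∫ y, v y ∂(T (x, u)))) - ε * ∫ y, v y ∂ρ := by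
  rw [sub_eq_add_neg, ciInf_add]
  · exact iInf_congr fun u => by ring
  · have hc : Continuous fun u => c (x, u) + ∫ y, v y ∂(T (x, u)) :=
      (hT.continuous.add (hT.weaklyContinuous v)).comp (Continuous.prodMk_right x)
    exact ⟨_, Set.forall_mem_range.2 fun u => iInf_le_of_continuous hc u⟩

lemma exists_isCanonicalTriplet [TopologicalSpace.MetrizableSpace U] [BorelSpace U]
    (hε : 0 < ε) (h : Minorized T ρ ε) (hT : Regular c T) :
    ∃ (g : ℝ) (v : X →ᵇ ℝ) (γ : X → U), Measurable γ ∧ IsCanonicalTriplet c T g v γ := by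
  obtain ⟨v, hv, -⟩ := existsUnique_isMinorizedFixedPoint hε h hT
  obtain ⟨γ, hγ, hγmin⟩ := exists_measurable_argmin (hT.continuous.add (hT.weaklyContinuous v))
  have key : ∀ x, ε * ∫ y, v y ∂ρ + v x = ⨅ u : U, (c (x, u) + ∫ y, v y ∂(T (x, u))) := by
    intro x
    have := hv x
    rw [minorizedBellman_eq hT] at this
    linarith
  exact ⟨_, v, γ, hγ, key, fun x => (key x).trans (hγmin x).symm⟩

/-- Up to an additive constant, the second component of a canonical triplet is the fixed point of
the minorized Bellman operator. -/
lemma IsCanonicalTriplet.exists_isMinorizedFixedPoint (hε : 0 < ε) (hT : Regular c T)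
    {g : ℝ} {v : X →ᵇ ℝ} {γ : X → U} (hv : IsCanonicalTriplet c T g v γ) :
    ∃ w : X →ᵇ ℝ, IsMinorizedFixedPoint c T ρ ε w ∧ g = ε * ∫ y, w y ∂ρ ∧
      IsCanonicalTriplet c T g w γ := by
  -- The shift that forces `ε ∫ w dρ = g`.
  let a : ℝ := g / ε - ∫ y, v y ∂ρ
  let w : X →ᵇ ℝ := v + BoundedContinuousFunction.const X a
  have hint : ∀ μ : Measure X, [IsProbabilityMeasure μ] → ∫ y, w y ∂μ = a + ∫ y, v y ∂μ := by
    intro μ _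
    rw [← integral_const_add_of_prob (integrable_boundedContinuousFunction v μ)]
    exact integral_congr_ae (ae_of_all _ fun y => add_comm (v y) a)
  have hw : ∀ x, w x = v x + a := fun x => rfl
  have hg : g = ε * ∫ y, w y ∂ρ := by
    rw [hint ρ]
    simp only [a]
    field_simp
    ring
  have h1 : ∀ x, g + w x = ⨅ u : U, (c (x, u) + ∫ y, w y ∂(T (x, u))) := by
    intro x
    have hc : Continuous fun u => c (x, u) + ∫ y, v y ∂(T (x, u)) :=
      (hT.continuous.add (hT.weaklyContinuous v)).comp (Continuous.prodMk_right x)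
    rw [hw, ← add_assoc, hv.1 x,
      ciInf_add ⟨_, Set.forall_mem_range.2 fun u => iInf_le_of_continuous hc u⟩]
    exact iInf_congr fun u => by rw [hint]; ring
  refine ⟨w, fun x => ?_, hg, h1, fun x => ?_⟩
  · rw [minorizedBellman_eq hT, ← h1, ← hg]
    ring
  · rw [hint, hw]
    linarith [hv.2 x]

omit [BorelSpace X] [CompactSpace U] [Nonempty U] [TopologicalSpace U] in
lemma disc_le_kernelDisc (T S : Kernel (X × U) X) [IsMarkovKernel T] [IsMarkovKernel S]
    (v : X →ᵇ ℝ) (z : X × U) : disc v (T z) (S z) ≤ kernelDisc v T S :=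
  le_ciSup (f := fun z => disc v (T z) (S z)) ⟨‖v‖ + ‖v‖, Set.forall_mem_range.2 fun _ =>
    (abs_sub _ _).trans (add_le_add
      (abs_integral_le_of_abs_le (abs_le_norm_boundedContinuousFunction v))
      (abs_integral_le_of_abs_le (abs_le_norm_boundedContinuousFunction v)))⟩ z

omit [IsMarkovKernel T] in
/-- Stability of the fixed point of the minorized Bellman operator in the data of the model. -/
lemma norm_sub_le_of_isMinorizedFixedPoint (hε : 0 < ε) (hSτ : Minorized S τ ε)
    (hT : Regular c T) (hS : Regular c' S) {v w : X →ᵇ ℝ}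
    (hv : IsMinorizedFixedPoint c T ρ ε v) (hw : IsMinorizedFixedPoint c' S τ ε w) {D : ℝ}
    (hD : ∀ z, |c' z - c z| + disc v (T z) (S z) ≤ D) :
    ε * ‖w - v‖ ≤ D + ε * disc v ρ τ := by
  have hε1 := hSτ.le_one
  have hd : 0 ≤ disc v ρ τ := abs_nonneg _
  obtain ⟨x₀⟩ := nonempty_of_isProbabilityMeasure ρ
  obtain ⟨u₀⟩ := ‹Nonempty U›
  have hD0 : 0 ≤ D := (add_nonneg (abs_nonneg _) (abs_nonneg _)).trans (hD (x₀, u₀))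
  -- The intermediate point is the `S`-operator applied to `v`: contraction controls its distance to
  -- `w`, and the data discrepancies at `v` control its distance to `v`.
  suffices ‖w - v‖ ≤ (1 - ε) * ‖w - v‖ + (D + ε * disc v ρ τ) by linarith
  refine (BoundedContinuousFunction.norm_le (add_nonneg
    (mul_nonneg (by linarith) (norm_nonneg _)) (by positivity))).2 fun x => ?_
  have h1 := hSτ.abs_minorizedBellman_sub_le hε hS w v x
  have h2 : |minorizedBellman c' S τ ε v x - minorizedBellman c T ρ ε v x| ≤
      D + ε * disc v ρ τ := by
    refine abs_iInf_sub_iInf_le ((hS.continuous_cost_add v _).comp (Continuous.prodMk_right x))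
      ((hT.continuous_cost_add v _).comp (Continuous.prodMk_right x)) fun u => ?_
    have hDu := hD (x, u)
    simp only [Function.comp_apply, disc] at hDu ⊢
    have e : c' (x, u) + (∫ y, v y ∂(S (x, u)) - ε * ∫ y, v y ∂τ) -
        (c (x, u) + (∫ y, v y ∂(T (x, u)) - ε * ∫ y, v y ∂ρ)) =
        (c' (x, u) - c (x, u)) - (∫ y, v y ∂(T (x, u)) - ∫ y, v y ∂(S (x, u))) +
          ε * (∫ y, v y ∂ρ - ∫ y, v y ∂τ) := by ring
    rw [e]
    refine (abs_add_le _ _).trans (add_le_add ((abs_sub _ _).trans hDu) ?_)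
    rw [abs_mul, abs_of_pos hε]
  have e : (w - v) x = (minorizedBellman c' S τ ε w x - minorizedBellman c' S τ ε v x) +
      (minorizedBellman c' S τ ε v x - minorizedBellman c T ρ ε v x) := by
    rw [hw x, hv x]
    simp
  rw [e, Real.norm_eq_abs]
  exact (abs_add_le _ _).trans (add_le_add h1 h2)

omit [IsMarkovKernel T] in
/-- The policy that is optimal for `(c', S)` nearly solves the optimality equation of `(c, T)`. -/
lemma IsCanonicalTriplet.cost_add_integral_le (hε : 0 < ε) (hSτ : Minorized S τ ε)
    (hT : Regular c T) (hS : Regular c' S) {g : ℝ} {v w : X →ᵇ ℝ} {γ : X → U}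
    (hv : IsMinorizedFixedPoint c T ρ ε v) (hw : IsCanonicalTriplet c' S g w γ) {D : ℝ}
    (hD : ∀ z, |c' z - c z| + disc v (T z) (S z) ≤ D) (x : X) :
    c (x, γ x) + ∫ y, v y ∂(T (x, γ x)) ≤
      ε * ∫ y, v y ∂ρ + 2 / ε * (D + ε * disc v ρ τ) + v x := by
  obtain ⟨k, hk, hg, hkγ⟩ := hw.exists_isMinorizedFixedPoint (ρ := τ) hε hS
  have hnorm := norm_sub_le_of_isMinorizedFixedPoint hε hSτ hT hS hv hk hD
  have h1 := hSτ.abs_integral_sub_le hε (x, γ x) (k - v).continuous.measurable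
    (abs_le_norm_boundedContinuousFunction (k - v))
  simp only [BoundedContinuousFunction.coe_sub, Pi.sub_apply] at h1
  rw [integral_sub (integrable_boundedContinuousFunction k _)
      (integrable_boundedContinuousFunction v _),
    integral_sub (integrable_boundedContinuousFunction k _)
      (integrable_boundedContinuousFunction v _)] at h1
  have h2 : |k x - v x| ≤ ‖k - v‖ := abs_le_norm_boundedContinuousFunction (k - v) x
  have h3 := hkγ.2 x
  have h4 := hD (x, γ x)
  -- Replacing `k` by `v` costs `(1 - ε)‖k - v‖` under the integrals and `‖k - v‖` at `x`, whence `2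
  -- - ε`; the last summand pays for changing the cost, the kernel and the minorizing measure.
  have h5 : 2 / ε * (D + ε * disc v ρ τ) =
      (2 - ε) / ε * (D + ε * disc v ρ τ) + (D + ε * disc v ρ τ) := by
    field_simp
    ring
  have h6 : (2 - ε) * ‖k - v‖ ≤ (2 - ε) / ε * (D + ε * disc v ρ τ) := by
    have h2ε : 0 ≤ (2 - ε) / ε := div_nonneg (by linarith [hSτ.le_one]) hε.le
    calc (2 - ε) * ‖k - v‖ = (2 - ε) / ε * (ε * ‖k - v‖) := by field_simp
      _ ≤ _ := mul_le_mul_of_nonneg_left hnorm h2ε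
  have h7 : ε * (∫ y, v y ∂τ - ∫ y, v y ∂ρ) ≤ ε * disc v ρ τ := by
    refine mul_le_mul_of_nonneg_left ?_ hε.le
    rw [disc, abs_sub_comm]
    exact le_abs_self _
  rw [h5]
  unfold disc at h4
  linarith [(abs_le.1 h1).1, (abs_le.1 h2).2, neg_abs_le (c' (x, γ x) - c (x, γ x)),
    le_abs_self (∫ y, v y ∂(T (x, γ x)) - ∫ y, v y ∂(S (x, γ x)))]

end Bellman

end MDP

/-! ### The robustness estimate. -/

theorem mainTheorem3
    {X U : Type*}
    [TopologicalSpace X] [PolishSpace X] [MeasurableSpace X] [BorelSpace X]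
    [TopologicalSpace U] [PolishSpace U] [CompactSpace U] [Nonempty U]
    [MeasurableSpace U] [BorelSpace U]
    (T S : Kernel (X × U) X) [IsMarkovKernel T] [IsMarkovKernel S]
    (c c' : X × U → ℝ)
    (hT : MDP.Regular c T) (hS : MDP.Regular c' S)
    (ρ τ : Measure X) [IsProbabilityMeasure ρ] [IsProbabilityMeasure τ]
    (ε : ℝ) (hε : 0 < ε)
    (hTρ : MDP.Minorized T ρ ε) (hSτ : MDP.Minorized S τ ε) :
    (∃! h : X →ᵇ ℝ, MDP.IsMinorizedFixedPoint c T ρ ε h) ∧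
    (∃ (g' : ℝ) (h' : X →ᵇ ℝ) (γ : X → U),
      Measurable γ ∧ MDP.IsCanonicalTriplet c' S g' h' γ) ∧
    ∀ h : X →ᵇ ℝ, MDP.IsMinorizedFixedPoint c T ρ ε h →
      ∀ (g' : ℝ) (h' : X →ᵇ ℝ) (γ : X → U) (hγ : Measurable γ),
        MDP.IsCanonicalTriplet c' S g' h' γ →
        ∀ x : X,
          |MDP.avgCost c T (MDP.Policy.stationary γ hγ) x - MDP.optAvgCost c T x| ≤
            (2 + ε) / ε * (MDP.supNorm (fun z => c z - c' z) + MDP.kernelDisc h T S)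
              + (2 + ε) * MDP.disc h ρ τ := by
  refine ⟨MDP.existsUnique_isMinorizedFixedPoint hε hTρ hT,
    MDP.exists_isCanonicalTriplet hε hSτ hS, fun h hh g' h' γ hγ hγc x => ?_⟩
  obtain ⟨M, hM⟩ := hT.bounded
  obtain ⟨M', hM'⟩ := hS.bounded
  set D := MDP.supNorm (fun z => c z - c' z) + MDP.kernelDisc h T S with hDdef
  have hD : ∀ z, |c' z - c z| + MDP.disc h (T z) (S z) ≤ D := fun z => by
    rw [abs_sub_comm]
    exact add_le_add (MDP.abs_sub_le_supNorm hM hM' z) (MDP.disc_le_kernelDisc T S h z)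
  obtain ⟨u₀⟩ := ‹Nonempty U›
  have hD0 : 0 ≤ D := (add_nonneg (abs_nonneg _) (abs_nonneg _)).trans (hD (x, u₀))
  have hd : 0 ≤ MDP.disc h ρ τ := abs_nonneg _
  have hK := MDP.abs_le_norm_boundedContinuousFunction h
  have hlower : ∀ π : MDP.Policy X U, ε * ∫ y, h y ∂ρ ≤ MDP.avgCost c T π x := by
    refine fun π => MDP.le_avgCost hT.continuous.measurable hM h.continuous.measurable hK
      (fun z => ?_) π x
    have h1 := hh z.1
    rw [MDP.minorizedBellman_eq hT] at h1
    have h2 := MDP.iInf_le_of_continuous (f := fun u => c (z.1, u) + ∫ y, h y ∂(T (z.1, u)))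
      ((hT.continuous.add (hT.weaklyContinuous h)).comp (Continuous.prodMk_right z.1)) z.2
    linarith
  have hupper := MDP.avgCost_stationary_le (T := T) hT.continuous.measurable hM hT.nonneg
    h.continuous.measurable hK hγ (hγc.cost_add_integral_le hε hSτ hT hS hh hD) x
  -- `hlower` also supplies the lower bound without which the real infimum over policies would be a
  -- default value.
  have hopt_le : MDP.optAvgCost c T x ≤ MDP.avgCost c T (MDP.Policy.stationary γ hγ) x :=
    ciInf_le ⟨_, Set.forall_mem_range.2 hlower⟩ _
  have hle_opt : ε * ∫ y, h y ∂ρ ≤ MDP.optAvgCost c T x :=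
    haveI : Nonempty (MDP.Policy X U) := ⟨MDP.Policy.stationary γ hγ⟩
    le_ciInf hlower
  rw [abs_of_nonneg (sub_nonneg.2 hopt_le)]
  -- The first summand already bounds the gap; the second is nonnegative slack.
  have e : (2 + ε) / ε * D + (2 + ε) * MDP.disc h ρ τ =
      2 / ε * (D + ε * MDP.disc h ρ τ) + (D + ε * MDP.disc h ρ τ) := by
    field_simp
  rw [e]
  have : 0 ≤ D + ε * MDP.disc h ρ τ := by positivity
  linarith
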